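/- Let $\mathscr{X}$ be a (right) Hilbert $C^*$-module over a unital $C^*$-algebra $\mathscr{A}$, with $\mathscr{A}$-valued inner product $\langle\cdot,\cdot\rangle$ that is conjugate linear in the first variable and linear in the second, and with norm $\|x\|=\|\langle x,x\rangle\|^{1/2}$. Let $\mathcal{L}(\mathscr{X})$ be the unital $C^*$-algebra of adjointable operators on $\mathscr{X}$. Let $J\subseteq\mathbb{R}$ be an interval with $0\in J$, and let $f:J\to\mathbb{R}$ be operator convex, that is, $f$ is continuous and $$f((1-\lambda)A+\lambda B)\le(1-\lambda)f(A)+\lambda f(B)$$ for all $\lambda\in[0,1]$ and all bounded self-adjoint operators $A,B$ on a complex Hilbert space whose spectra are contained in $J$. Suppose that $f(0)\le 0$. Let $S,T_1,\dots,T_n,R_1,\dots,R_n\in\mathcal{L}(\mathscr{X})$, where $S$ and all $T_i$ are self-adjoint, and suppose that the spectra of $S-\sum_{i=1}^nR_i^*T_iR_i$ and of each $T_i$ are contained in $J$. Let $x\in\mathscr{X}$ with $\|x\|\le1$ and put $k_n=\bigl(1+\sum_{i=1}^n\|R_ix\|^2\bigr)^{-1}$. Then the spectrum of the self-adjoint element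 $k_n\langle x,Sx\rangle$ of $\mathscr{A}$ is contained in $J$ (so that $f(k_n\langle x,Sx\rangle)$ is defined), and, in the order of $\mathscr{A}$, $$\Bigl\langle x,\Bigl[f\Bigl(S-\sum_{i=1}^nR_i^*T_iR_i\Bigr)+\sum_{i=1}^nR_i^*f(T_i)R_i\Bigr]x\Bigr\rangle\ \ge\ k_n^{-1}\,f\bigl(k_n\langle x,Sx\rangle\bigr).$$ Here $f$ of a self-adjoint element with spectrum in $J$ is given by the continuous functional calculus. -/

import Mathlib

universe u v w

open MulOpposite

/-- Operator convexity of a real function on a set `J ⊆ ℝ` (an interval in the applications):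
`f` is continuous on `J`, and `f ((1 - c) S + c T) ≤ (1 - c) f(S) + c f(T)` for all bounded
self-adjoint operators `S`, `T` on a complex Hilbert space `H` whose spectra lie in `J`.
Here `f(S)` is the continuous functional calculus and `≤` is the Loewner order. -/
def OperatorConvexOn (J : Set ℝ) (f : ℝ → ℝ) : Prop :=
  ContinuousOn f J ∧
    ∀ (H : Type w) [NormedAddCommGroup H] [InnerProductSpace ℂ H] [CompleteSpace H]
      (S T : H →L[ℂ] H), IsSelfAdjoint S → IsSelfAdjoint T →
      spectrum ℝ S ⊆ J → spectrum ℝ T ⊆ J →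
      ∀ c ∈ Set.Icc (0 : ℝ) 1,
        cfc f ((1 - c) • S + c • T) ≤ (1 - c) • cfc f S + c • cfc f T

/-!
A right Hilbert `A`-module is a complete `CStarModule Aᵐᵒᵖ X`: Mathlib's class asks for
`⟪x, a • y⟫ = a * ⟪x, y⟫`, so over the opposite algebra, with `y a = op a • y`, it is the usual
axiom `⟨x, y a⟩ = ⟨x, y⟩ a` of a right module (see `HilbertModule.ip_mul_right`).
-/

namespace HilbertModule

section

variable (A : Type u) {X : Type v} [CStarAlgebra A] [PartialOrder A] [StarOrderedRing A]
  [NormedAddCommGroup X] [NormedSpace ℂ X] [Module Aᵐᵒᵖ X] [CStarModule Aᵐᵒᵖ X]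

/-- The `A`-valued inner product `⟨x, y⟩` of a right Hilbert `A`-module, conjugate linear in the
first variable and linear in the second. -/
def ip (x y : X) : A := unop (inner Aᵐᵒᵖ x y)

theorem ip_mul_right (x y : X) (a : A) : ip A x (op a • y) = ip A x y * a := by
  simp [ip]

theorem ip_add_right (x y z : X) : ip A x (y + z) = ip A x y + ip A x z := by
  simp [ip]

theorem ip_smul_right (c : ℂ) (x y : X) : ip A x (c • y) = c • ip A x y := by
  simp [ip]

theorem star_ip (x y : X) : star (ip A x y) = ip A y x := by
  simp [ip, ← unop_star]

theorem ip_add_left (x y z : X) : ip A (x + y) z = ip A x z + ip A y z := by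
  rw [← star_ip, ip_add_right, star_add, star_ip, star_ip]

theorem ip_smul_left (c : ℂ) (x y : X) : ip A (c • x) y = star c • ip A x y := by
  rw [← star_ip, ip_smul_right, star_smul, star_ip]

theorem ip_self_nonneg (x : X) : 0 ≤ ip A x x :=
  CStarModule.inner_self_nonneg (A := Aᵐᵒᵖ) (x := x)

theorem norm_sq_eq (x : X) : ‖x‖ ^ 2 = ‖ip A x x‖ :=
  CStarModule.norm_sq_eq Aᵐᵒᵖ

theorem norm_ip_le (x y : X) : ‖ip A x y‖ ≤ ‖x‖ * ‖y‖ :=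
  CStarModule.norm_inner_le (A := Aᵐᵒᵖ) X

theorem continuous_ip : Continuous fun p : X × X => ip A p.1 p.2 :=
  continuous_unop.comp (CStarModule.continuous_inner (A := Aᵐᵒᵖ))

theorem ext_ip {x y : X} (h : ∀ z, ip A z x = ip A z y) : x = y := by
  have h0 : ip A (x - y) (x - y) = 0 := by
    have h1 : ip A (x - y) (x - y) + ip A (x - y) y = ip A (x - y) x := by
      rw [← ip_add_right, sub_add_cancel]
    rw [h] at h1
    simpa using h1
  have h2 := norm_sq_eq A (x - y)
  rw [h0] at h2
  have h3 : ‖x - y‖ = 0 := by simpa using h2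
  exact sub_eq_zero.mp (norm_eq_zero.mp h3)

/-- `S` is an adjoint of the mapping `T : X → X`. -/
def IsAdjointPair (T S : X → X) : Prop := ∀ x y, ip A (T x) y = ip A x (S y)

/-- A mapping `T : X → X` is adjointable if it has an adjoint. -/
def IsAdjointable (T : X → X) : Prop := ∃ S : X → X, IsAdjointPair A T S

variable {A}

theorem IsAdjointPair.symm {T S : X → X} (h : IsAdjointPair A T S) : IsAdjointPair A S T := by
  intro x y
  rw [← star_ip, ← h, star_ip]

/-- Adjointable mappings are automatically linear and bounded. -/
theorem IsAdjointPair.exists_clm [CompleteSpace X] {T S : X → X} (h : IsAdjointPair A T S) :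
    ∃ T' : X →L[ℂ] X, ⇑T' = T := by
  have h' := h.symm
  let L : X →ₗ[ℂ] X :=
    { toFun := T
      map_add' := fun x y => ext_ip A fun z => by
        rw [← h', ip_add_right, ip_add_right, h', h']
      map_smul' := fun c x => ext_ip A fun z => by
        rw [← h', RingHom.id_apply, ip_smul_right, ip_smul_right, h'] }
  refine ⟨⟨L, L.continuous_of_seq_closed_graph ?_⟩, rfl⟩
  intro s x y hs hT
  refine ext_ip A fun z => ?_
  have e1 : Filter.Tendsto (fun n => ip A z (L (s n))) Filter.atTop (nhds (ip A z y)) :=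
    ((continuous_ip A).tendsto (z, y)).comp (tendsto_const_nhds.prodMk_nhds hT)
  have e2 : Filter.Tendsto (fun n => ip A (S z) (s n)) Filter.atTop (nhds (ip A (S z) x)) :=
    ((continuous_ip A).tendsto (S z, x)).comp (tendsto_const_nhds.prodMk_nhds hs)
  have e3 : (fun n => ip A z (L (s n))) = fun n => ip A (S z) (s n) :=
    funext fun n => (h' z (s n)).symm
  rw [e3] at e1
  rw [tendsto_nhds_unique e1 e2]
  exact h' z x

theorem IsAdjointPair.norm_sq_apply_le {T S : X →L[ℂ] X} (h : IsAdjointPair A T S) (x : X) :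
    ‖T x‖ ^ 2 ≤ ‖S * T‖ * ‖x‖ ^ 2 := by
  rw [norm_sq_eq A, h]
  calc ‖ip A x (S (T x))‖ ≤ ‖x‖ * ‖(S * T) x‖ := norm_ip_le A _ _
    _ ≤ ‖x‖ * (‖S * T‖ * ‖x‖) := by gcongr; exact (S * T).le_opNorm x
    _ = ‖S * T‖ * ‖x‖ ^ 2 := by ring

theorem IsAdjointPair.norm_sq_le {T S : X →L[ℂ] X} (h : IsAdjointPair A T S) :
    ‖T‖ ^ 2 ≤ ‖S * T‖ := by
  have h1 : ‖T‖ ≤ √‖S * T‖ := by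
    refine T.opNorm_le_bound (Real.sqrt_nonneg _) fun x => ?_
    refine le_of_sq_le_sq ?_ (by positivity)
    rw [mul_pow, Real.sq_sqrt (norm_nonneg _)]
    exact h.norm_sq_apply_le x
  calc ‖T‖ ^ 2 ≤ √‖S * T‖ ^ 2 := by gcongr
    _ = ‖S * T‖ := Real.sq_sqrt (norm_nonneg _)

theorem IsAdjointPair.norm_le {T S : X →L[ℂ] X} (h : IsAdjointPair A T S) : ‖T‖ ≤ ‖S‖ := by
  by_contra! hlt
  have h1 := h.norm_sq_le.trans (norm_mul_le S T)
  nlinarith [norm_nonneg S, norm_nonneg T]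

theorem IsAdjointPair.sub {T S T' S' : X →L[ℂ] X} (h : IsAdjointPair A T S)
    (h' : IsAdjointPair A T' S') : IsAdjointPair A (T - T' : X →L[ℂ] X) (S - S' : X →L[ℂ] X) := by
  intro x y
  have e1 : ip A ((T - T') x) y + ip A (T' x) y = ip A (T x) y := by
    rw [← ip_add_left]; simp
  have e2 : ip A x ((S - S') y) + ip A x (S' y) = ip A x (S y) := by
    rw [← ip_add_right]; simp
  rw [h, h', ← e2] at e1
  exact add_right_cancel e1

end

section

variable (A : Type u) (X : Type v) [CStarAlgebra A] [PartialOrder A] [StarOrderedRing A]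
  [NormedAddCommGroup X] [NormedSpace ℂ X] [Module Aᵐᵒᵖ X] [CStarModule Aᵐᵒᵖ X]

/-- The adjointable mappings, as a subalgebra of the bounded operators on `X`
(by `IsAdjointPair.exists_clm` nothing is lost by starting from bounded operators). -/
def adjointableSubalgebra : Subalgebra ℂ (X →L[ℂ] X) where
  carrier := {T | IsAdjointable A T}
  mul_mem' := by
    rintro T T' ⟨S, hS⟩ ⟨S', hS'⟩
    refine ⟨S' ∘ S, fun x y => ?_⟩
    exact (hS (T' x) y).trans (hS' x (S y))
  add_mem' := by
    rintro T T' ⟨S, hS⟩ ⟨S', hS'⟩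
    refine ⟨S + S', fun x y => ?_⟩
    simp only [add_apply, Pi.add_apply, ip_add_left, ip_add_right]
    rw [hS, hS']
  algebraMap_mem' := by
    intro c
    refine ⟨fun y => star c • y, fun x y => ?_⟩
    rw [Algebra.algebraMap_eq_smul_one, ip_smul_right, smul_apply,
      ip_smul_left, one_apply_eq_self]

/-- The algebra `𝓛(X)` of adjointable operators on the right Hilbert `A`-module `X`, with the
operator norm. -/
abbrev Adjointable : Type v := adjointableSubalgebra A X

variable {A X}

/-- The evaluation `T x`. -/
instance : CoeFun (Adjointable A X) (fun _ => X → X) := ⟨fun T => (T : X →L[ℂ] X)⟩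

variable [CompleteSpace X]

theorem Adjointable.exists_adjoint (T : Adjointable A X) :
    ∃ S : Adjointable A X, IsAdjointPair A T S := by
  obtain ⟨T, S, hS⟩ := T
  obtain ⟨S', rfl⟩ := hS.symm.exists_clm
  exact ⟨⟨S', T, hS.symm⟩, hS⟩

/-- The adjoint `T*`. -/
noncomputable instance : Star (Adjointable A X) := ⟨fun T => T.exists_adjoint.choose⟩

theorem Adjointable.ip_apply_left (T : Adjointable A X) : IsAdjointPair A T (star T : Adjointable A X) :=
  T.exists_adjoint.choose_spec

theorem Adjointable.star_eq {T S : Adjointable A X} (h : IsAdjointPair A T S) : star T = S := by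
  refine Subtype.ext (ContinuousLinearMap.ext fun y => ext_ip A fun z => ?_)
  rw [← T.ip_apply_left, h]

noncomputable instance : StarRing (Adjointable A X) where
  star_involutive T := Adjointable.star_eq T.ip_apply_left.symm
  star_mul T T' := Adjointable.star_eq fun x y =>
    (T.ip_apply_left (T' x) y).trans (T'.ip_apply_left x (star T y))
  star_add T T' := Adjointable.star_eq fun x y => by
    change ip A (T x + T' x) y = ip A x (star T y + star T' y)
    rw [ip_add_left, ip_add_right, T.ip_apply_left, T'.ip_apply_left]

instance : StarModule ℂ (Adjointable A X) where
  star_smul c T := Adjointable.star_eq fun x y => by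
    change ip A (c • T x) y = ip A x (star c • star T y)
    rw [ip_smul_left, ip_smul_right, T.ip_apply_left]

instance : CStarRing (Adjointable A X) where
  norm_mul_self_le T := by
    have h := T.ip_apply_left.norm_sq_le
    rw [pow_two] at h
    exact h

instance : CompleteSpace (Adjointable A X) := by
  suffices h : IsClosed (adjointableSubalgebra A X : Set (X →L[ℂ] X)) from h.completeSpace_coe
  refine isClosed_of_closure_subset fun T hT => ?_
  obtain ⟨s, hs, hlim⟩ := mem_closure_iff_seq_limit.mp hT
  let t : ℕ → Adjointable A X := fun n => ⟨s n, hs n⟩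
  let r : ℕ → (X →L[ℂ] X) := fun n => (star (t n) : Adjointable A X)
  have hr : CauchySeq r := by
    have hc := hlim.cauchySeq
    rw [Metric.cauchySeq_iff] at hc ⊢
    intro ε hε
    obtain ⟨N, hN⟩ := hc ε hε
    refine ⟨N, fun m hm n hn => lt_of_le_of_lt ?_ (hN m hm n hn)⟩
    rw [dist_eq_norm, dist_eq_norm]
    exact ((t m).ip_apply_left.sub (t n).ip_apply_left).symm.norm_le
  obtain ⟨S, hS⟩ := cauchySeq_tendsto_of_complete hr
  refine ⟨S, fun x y => ?_⟩
  have e1 : Filter.Tendsto (fun n => ip A (s n x) y) Filter.atTop (nhds (ip A (T x) y)) :=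
    ((continuous_ip A).tendsto (T x, y)).comp
      (((ContinuousLinearMap.apply ℂ X x).continuous.tendsto T |>.comp hlim).prodMk_nhds
        tendsto_const_nhds)
  have e2 : Filter.Tendsto (fun n => ip A x (r n y)) Filter.atTop (nhds (ip A x (S y))) :=
    ((continuous_ip A).tendsto (x, S y)).comp
      (tendsto_const_nhds.prodMk_nhds
        ((ContinuousLinearMap.apply ℂ X y).continuous.tendsto S |>.comp hS))
  have e3 : (fun n => ip A (s n x) y) = fun n => ip A x (r n y) :=
    funext fun n => (t n).ip_apply_left x y
  rw [e3] at e1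
  exact tendsto_nhds_unique e1 e2

/-- `𝓛(X)` is a unital C⋆-algebra; this makes the continuous functional calculus available. -/
noncomputable instance : CStarAlgebra (Adjointable A X) where

end

end HilbertModule

/-!
The GNS representations separate the positive elements of a C⋆-algebra and commute with the
functional calculus, so an operator convex function is convex on every C⋆-algebra.

Let `⟨x, x⟩ = 1`. Then `p = |x⟩⟨x|` is a projection in `𝓛(X)`, and the pinching
`p T p + (1 - p) T (1 - p)` is the midpoint of `T` and its conjugate by the symmetry `2 * p - 1`, so
convexity bounds `f` of the pinching by the pinching of `f(T)`. As `x` is an eigenvector of the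
pinching, with right eigenvalue `⟨x, T x⟩`, evaluating at `x` yields Jensen's inequality
`f(⟨x, T x⟩) ≤ ⟨x, f(T) x⟩`.

A vector with `⟨x, x⟩ ≤ 1` is dilated to the unit vector `(√(1 - ⟨x, x⟩), x)` of `A ⊕ X`, on which
`0 ⊕ T` acts; this is where `f 0 ≤ 0` enters. The theorem is Jensen's inequality for the vector
`√k (x, R₁ x, …, Rₙ x)` and the operator `diag(S - ∑ Rᵢ* Tᵢ Rᵢ, T₁, …, Tₙ)`.
-/

section CStarAlgebra

open scoped ComplexOrder

theorem spectrum_zero_subset {B : Type*} [Ring B] [Algebra ℝ B] : spectrum ℝ (0 : B) ⊆ {0} := by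
  cases subsingleton_or_nontrivial B
  · simp only [spectrum.of_subsingleton, Set.empty_subset]
  · rw [spectrum.zero_eq]

theorem exists_positiveLinearMap_apply_eq {A : Type*} [CStarAlgebra A] [PartialOrder A]
    [StarOrderedRing A] (g : A →ₗ[ℝ] ℝ) (hg : ∀ b, 0 ≤ b → 0 ≤ g b) :
    ∃ φ : A →ₚ[ℂ] ℂ, ∀ b, IsSelfAdjoint b → φ b = g b := by
  let g' : Module.Dual ℝ A := g ∘ₗ (selfAdjoint.submodule ℝ A).subtype ∘ₗ realPart
  have extend_apply (b : A) (hb : IsSelfAdjoint b) : g'.extendRCLike (𝕜 := ℂ) b = g b := by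
    have hre : g' b = g b := congrArg g hb.coe_realPart
    have him : g' (Complex.I • b) = 0 := by
      change g (realPart (Complex.I • b) : selfAdjoint A) = 0
      simp [realPart_I_smul, hb.imaginaryPart]
    simp [Module.Dual.extendRCLike_apply, hre, him]
  refine ⟨PositiveLinearMap.mk₀ (g'.extendRCLike (𝕜 := ℂ)) fun b hb => ?_, extend_apply⟩
  rw [extend_apply b hb.isSelfAdjoint]
  exact_mod_cast hg b hb

theorem nonneg_of_forall_positiveLinearMap {A : Type*} [CStarAlgebra A]
    [PartialOrder A] [StarOrderedRing A] {a : A} (ha : IsSelfAdjoint a)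
    (h : ∀ φ : A →ₚ[ℂ] ℂ, 0 ≤ φ a) : 0 ≤ a := by
  by_contra hneg
  obtain ⟨g, hg, hga⟩ := (ProperCone.positive ℝ A).hyperplane_separation_point
    (by rwa [ProperCone.mem_positive])
  obtain ⟨φ, hφ⟩ := exists_positiveLinearMap_apply_eq g.toLinearMap fun b hb =>
    hg b ((ProperCone.mem_positive).mpr hb)
  have hφa : (0 : ℂ) ≤ (g a : ℝ) := by simpa [hφ a ha] using h φ
  exact hga.not_ge (by exact_mod_cast hφa)

theorem nonneg_of_forall_gns {A : Type*} [CStarAlgebra A] [PartialOrder A]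
    [StarOrderedRing A] {a : A} (ha : IsSelfAdjoint a)
    (h : ∀ φ : A →ₚ[ℂ] ℂ, 0 ≤ φ.gnsStarAlgHom a) : 0 ≤ a := by
  refine nonneg_of_forall_positiveLinearMap ha fun φ => ?_
  have vector_state_nonneg := ((ContinuousLinearMap.nonneg_iff_isPositive _).mp
    (h φ)).inner_nonneg_right (φ.toPreGNS 1 : φ.GNS)
  simpa [PositiveLinearMap.gnsStarAlgHom_apply, UniformSpace.Completion.inner_coe,
    PositiveLinearMap.preGNS_inner_def] using vector_state_nonneg

theorem spectrum_map_subset_of_ordConnected {A B : Type*} [CStarAlgebra A] [PartialOrder A]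
    [StarOrderedRing A] [CStarAlgebra B] [PartialOrder B] [StarOrderedRing B]
    (Φ : B →ₚ[ℝ] A) (hΦ : Φ 1 = 1) {J : Set ℝ} (hJ : J.OrdConnected) {b : B}
    (hb : IsSelfAdjoint b) (hbJ : spectrum ℝ b ⊆ J) : spectrum ℝ (Φ b) ⊆ J := by
  nontriviality A
  have : Nontrivial B := ⟨0, 1, fun h => zero_ne_one (α := A) (by rw [← hΦ, ← h, map_zero])⟩
  have hcompact := ContinuousFunctionalCalculus.isCompact_spectrum (R := ℝ) b
  have hne := ContinuousFunctionalCalculus.spectrum_nonempty (R := ℝ) b hb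
  obtain ⟨m, hm, hmin⟩ := hcompact.exists_isLeast hne
  obtain ⟨M, hM, hmax⟩ := hcompact.exists_isGreatest hne
  have map_algebraMap (r : ℝ) : Φ (algebraMap ℝ B r) = algebraMap ℝ A r := by
    rw [Algebra.algebraMap_eq_smul_one, map_smul, hΦ, Algebra.algebraMap_eq_smul_one]
  have lower : algebraMap ℝ A m ≤ Φ b :=
    map_algebraMap m ▸ OrderHomClass.mono Φ ((algebraMap_le_iff_le_spectrum hb).mpr hmin)
  have upper : Φ b ≤ algebraMap ℝ A M :=
    map_algebraMap M ▸ OrderHomClass.mono Φ ((le_algebraMap_iff_spectrum_le hb).mpr hmax)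
  have hΦb : IsSelfAdjoint (Φ b) := .of_ge lower (.algebraMap A (.all m))
  exact fun y hy => hJ.out (hbJ hm) (hbJ hM) ⟨(algebraMap_le_iff_le_spectrum hΦb).mp lower y hy,
    (le_algebraMap_iff_spectrum_le hΦb).mp upper y hy⟩

theorem spectrum_convexCombination_subset {A : Type*} [CStarAlgebra A] [PartialOrder A]
    [StarOrderedRing A] {J : Set ℝ} (hJ : J.OrdConnected) {a b : A} (ha : IsSelfAdjoint a)
    (hb : IsSelfAdjoint b) (haJ : spectrum ℝ a ⊆ J) (hbJ : spectrum ℝ b ⊆ J) {c : ℝ}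
    (hc : c ∈ Set.Icc (0 : ℝ) 1) : spectrum ℝ ((1 - c) • a + c • b) ⊆ J := by
  let combination : A × A →ₚ[ℝ] A := PositiveLinearMap.mk₀
    ((1 - c) • LinearMap.fst ℝ A A + c • LinearMap.snd ℝ A A) fun p hp =>
      add_nonneg (smul_nonneg (α := ℝ) (sub_nonneg.mpr hc.2) hp.1)
        (smul_nonneg (α := ℝ) hc.1 hp.2)
  refine spectrum_map_subset_of_ordConnected combination ?_ hJ (b := (a, b)) ?_ ?_
  · change (1 - c) • (1 : A) + c • (1 : A) = 1
    rw [← add_smul, sub_add_cancel, one_smul]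
  · exact Prod.ext ha hb
  · exact (Prod.spectrum_eq (R := ℝ) a b).trans_subset (Set.union_subset haJ hbJ)

theorem isSelfAdjoint_convexCombination {A : Type*} [CStarAlgebra A] {a b : A}
    (ha : IsSelfAdjoint a) (hb : IsSelfAdjoint b) (c : ℝ) :
    IsSelfAdjoint ((1 - c) • a + c • b) :=
  ((IsSelfAdjoint.all _).smul ha).add ((IsSelfAdjoint.all _).smul hb)

theorem OperatorConvexOn.cfc_convexCombination_le {A : Type w} [CStarAlgebra A] [PartialOrder A]
    [StarOrderedRing A] {J : Set ℝ} {f : ℝ → ℝ} (hf : OperatorConvexOn.{w} J f)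
    (hJ : J.OrdConnected) {a b : A} (ha : IsSelfAdjoint a) (hb : IsSelfAdjoint b)
    (haJ : spectrum ℝ a ⊆ J) (hbJ : spectrum ℝ b ⊆ J) {c : ℝ} (hc : c ∈ Set.Icc (0 : ℝ) 1) :
    cfc f ((1 - c) • a + c • b) ≤ (1 - c) • cfc f a + c • cfc f b := by
  have hab := isSelfAdjoint_convexCombination ha hb c
  have hfab := isSelfAdjoint_convexCombination (cfc_predicate f a) (cfc_predicate f b) c
  rw [← sub_nonneg]
  refine nonneg_of_forall_gns (hfab.sub (cfc_predicate f _)) fun φ => ?_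
  set π := φ.gnsStarAlgHom
  have map_cfc (d : A) (hd : IsSelfAdjoint d) (hdJ : spectrum ℝ d ⊆ J) :
      π (cfc f d) = cfc f (π d) :=
    StarAlgHomClass.map_cfc (S := ℂ) π f d (hf.1.mono hdJ) (by fun_prop) hd (hd.map π)
  have spectrum_map_subset (d : A) : spectrum ℝ (π d) ⊆ spectrum ℝ d :=
    AlgHom.spectrum_apply_subset (π.restrictScalars ℝ) d
  have map_real_smul (r : ℝ) (d : A) : π (r • d) = r • π d := map_smul (π.restrictScalars ℝ) r d
  have hilbert := hf.2 φ.GNS (π a) (π b) (ha.map π) (hb.map π)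
    ((spectrum_map_subset a).trans haJ) ((spectrum_map_subset b).trans hbJ) c hc
  rw [map_sub, sub_nonneg,
    map_cfc _ hab (spectrum_convexCombination_subset hJ ha hb haJ hbJ hc)]
  simpa only [map_add, map_real_smul, map_cfc a ha haJ, map_cfc b hb hbJ] using hilbert

theorem continuous_starAlgHom {A B : Type*} [CStarAlgebra A] [CStarAlgebra B] (Φ : A →⋆ₐ[ℂ] B) :
    Continuous Φ :=
  NonUnitalStarAlgHom.instContinuousLinearMapClassComplex.map_continuous Φ

section Prod

variable {A B C : Type*} [CStarAlgebra A] [CStarAlgebra B] [CStarAlgebra C] {f : ℝ → ℝ}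

-- Instance search does not find the C⋆-algebra structure of a product here.
instance : ContinuousFunctionalCalculus ℝ (A × B) IsSelfAdjoint :=
  IsSelfAdjoint.instContinuousFunctionalCalculus

theorem prodMk_cfc_mem {S : StarSubalgebra ℂ (A × B)} (hS : IsClosed (S : Set (A × B))) {a : A}
    {b : B} (ha : IsSelfAdjoint a) (hb : IsSelfAdjoint b)
    (hf : ContinuousOn f (spectrum ℝ a ∪ spectrum ℝ b)) (hab : (a, b) ∈ S) :
    (cfc f a, cfc f b) ∈ S := by
  rw [← cfc_map_prod (S := ℂ) f a b hf (show IsSelfAdjoint (a, b) from Prod.ext ha hb) ha hb]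
  exact cfc_mem (𝕜' := ℂ) f hab

theorem map_prodMk_cfc (Φ : A × B →⋆ₐ[ℂ] C) {a : A} {b : B} (ha : IsSelfAdjoint a)
    (hb : IsSelfAdjoint b) (hf : ContinuousOn f (spectrum ℝ a ∪ spectrum ℝ b)) :
    Φ (cfc f a, cfc f b) = cfc f (Φ (a, b)) := by
  have hab : IsSelfAdjoint (a, b) := Prod.ext ha hb
  rw [← cfc_map_prod (S := ℂ) f a b hf hab ha hb]
  exact StarAlgHomClass.map_cfc (S := ℂ) Φ f (a, b)
    (hf.mono (Prod.spectrum_eq (R := ℝ) a b).subset) (continuous_starAlgHom Φ) hab (hab.map Φ)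

end Prod

section Pi

variable {ι : Type*} [Finite ι] {B : ι → Type*} [∀ i, CStarAlgebra (B i)] {C : Type*}
  [CStarAlgebra C]

instance : ContinuousFunctionalCalculus ℝ (∀ i, B i) IsSelfAdjoint :=
  have := Fintype.ofFinite ι
  IsSelfAdjoint.instContinuousFunctionalCalculus

theorem map_pi_cfc (Φ : (∀ i, B i) →⋆ₐ[ℂ] C) {b : ∀ i, B i} (hb : ∀ i, IsSelfAdjoint (b i))
    {f : ℝ → ℝ} (hf : ContinuousOn f (⋃ i, spectrum ℝ (b i))) :
    Φ (fun i => cfc f (b i)) = cfc f (Φ b) := by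
  have := Fintype.ofFinite ι
  have hb' : IsSelfAdjoint b := funext hb
  rw [← cfc_map_pi (S := ℂ) f b hf hb' hb]
  exact StarAlgHomClass.map_cfc (S := ℂ) Φ f b
    (hf.mono (Pi.spectrum_eq (R := ℝ) b).subset) (continuous_starAlgHom Φ) hb' (hb'.map Φ)

end Pi

/-- The pinching `p a p + (1 - p) a (1 - p)` of `a` by a projection `p`: it keeps the diagonal
blocks of `a` with respect to `p` and deletes the off-diagonal ones. -/
def pinching {A : Type*} [Ring A] (p a : A) : A := p * a * p + (1 - p) * a * (1 - p)

section Pinching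

variable {A : Type w} [CStarAlgebra A] {p a : A}

/-- The symmetry `2 * p - 1` of a projection `p`, as a unitary. -/
def projectionSymmetry (hp : IsStarProjection p) : unitary A :=
  ⟨2 * p - 1, hp.two_mul_sub_one_mem_unitary⟩

theorem pinching_eq_convexCombination (hp : IsStarProjection p) (a : A) :
    pinching p a = (1 - 1 / 2 : ℝ) • a +
      (1 / 2 : ℝ) • Unitary.conjStarAlgAut ℂ A (projectionSymmetry hp) a := by
  have hsymm : star (2 * p - 1) = 2 * p - 1 := by
    simp [hp.isSelfAdjoint.star_eq, two_mul]
  have expand : (2 : ℝ) • pinching p a = a + (2 * p - 1) * a * (2 * p - 1) := by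
    rw [two_smul, pinching]
    noncomm_ring
  rw [Unitary.conjStarAlgAut_apply, projectionSymmetry, hsymm,
    ← inv_smul_smul₀ (two_ne_zero' ℝ) (pinching p a), expand, smul_add]
  norm_num

theorem spectrum_conjStarAlgAut (u : unitary A) (a : A) :
    spectrum ℝ (Unitary.conjStarAlgAut ℂ A u a) = spectrum ℝ a := by
  rw [Unitary.conjStarAlgAut_apply, Unitary.spectrum_star_right_conjugate]

theorem isSelfAdjoint_pinching (hp : IsStarProjection p) (ha : IsSelfAdjoint a) :
    IsSelfAdjoint (pinching p a) := by
  rw [pinching_eq_convexCombination hp]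
  exact isSelfAdjoint_convexCombination ha (ha.map _) _

variable [PartialOrder A] [StarOrderedRing A] {J : Set ℝ} {f : ℝ → ℝ}

theorem spectrum_pinching_subset (hJ : J.OrdConnected) (hp : IsStarProjection p)
    (ha : IsSelfAdjoint a) (haJ : spectrum ℝ a ⊆ J) : spectrum ℝ (pinching p a) ⊆ J := by
  rw [pinching_eq_convexCombination hp]
  exact spectrum_convexCombination_subset hJ ha (ha.map _) haJ
    ((spectrum_conjStarAlgAut _ a).trans_subset haJ) (by norm_num)

theorem OperatorConvexOn.cfc_pinching_le (hf : OperatorConvexOn.{w} J f) (hJ : J.OrdConnected)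
    (hp : IsStarProjection p) (ha : IsSelfAdjoint a) (haJ : spectrum ℝ a ⊆ J) :
    cfc f (pinching p a) ≤ pinching p (cfc f a) := by
  set σ := Unitary.conjStarAlgAut ℂ A (projectionSymmetry hp)
  have hσ : σ (cfc f a) = cfc f (σ a) :=
    StarAlgHomClass.map_cfc (S := ℂ) σ f a (hf.1.mono haJ)
      (by fun_prop) ha (ha.map σ)
  rw [pinching_eq_convexCombination hp a, pinching_eq_convexCombination hp (cfc f a), hσ]
  exact hf.cfc_convexCombination_le hJ ha (ha.map σ) haJ
    ((spectrum_conjStarAlgAut _ a).trans_subset haJ) (by norm_num)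

end Pinching

end CStarAlgebra

namespace HilbertModule

section Adjointable

variable {A : Type u} {X : Type v} [CStarAlgebra A] [PartialOrder A] [StarOrderedRing A]
  [NormedAddCommGroup X] [NormedSpace ℂ X] [Module Aᵐᵒᵖ X] [CStarModule Aᵐᵒᵖ X]

theorem ip_sum_right {ι : Type*} (s : Finset ι) (x : X) (y : ι → X) :
    ip A x (∑ i ∈ s, y i) = ∑ i ∈ s, ip A x (y i) :=
  map_sum (AddMonoidHom.mk' (ip A x) (ip_add_right A x)) y s

theorem ip_real_smul_right (r : ℝ) (x y : X) : ip A x (r • y) = r • ip A x y :=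
  ip_smul_right A (r : ℂ) x y

theorem ip_real_smul_left (r : ℝ) (x y : X) : ip A (r • x) y = r • ip A x y := by
  rw [← star_ip, ip_real_smul_right, star_smul, star_ip, star_trivial]

theorem ip_op_smul_left (x y : X) (a : A) : ip A (op a • x) y = star a * ip A x y := by
  rw [← star_ip, ip_mul_right, star_mul, star_ip]

namespace Adjointable

theorem ext {T S : Adjointable A X} (h : ∀ x, T x = S x) : T = S :=
  Subtype.ext (ContinuousLinearMap.ext h)

theorem mul_apply (T S : Adjointable A X) (x : X) : (T * S) x = T (S x) := rfl

theorem add_apply (T S : Adjointable A X) (x : X) : (T + S) x = T x + S x := rfl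

theorem sum_apply {ι : Type*} (s : Finset ι) (T : ι → Adjointable A X) (x : X) :
    (∑ i ∈ s, T i) x = ∑ i ∈ s, T i x :=
  map_sum (AddMonoidHom.mk' (fun T : Adjointable A X => T x) fun _ _ => rfl) T s

variable [CompleteSpace X]

/-- The adjointable operator with underlying mapping `T`, built from an adjoint pair `T, S`;
linearity and boundedness of `T` are automatic. -/
noncomputable def ofIsAdjointPair {T S : X → X} (h : IsAdjointPair A T S) : Adjointable A X :=
  ⟨h.exists_clm.choose, S, by rwa [h.exists_clm.choose_spec]⟩

theorem ofIsAdjointPair_apply {T S : X → X} (h : IsAdjointPair A T S) (x : X) :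
    ofIsAdjointPair h x = T x :=
  congrFun h.exists_clm.choose_spec x

theorem star_ofIsAdjointPair {T S : X → X} (h : IsAdjointPair A T S) :
    star (ofIsAdjointPair h) = ofIsAdjointPair h.symm :=
  star_eq fun x y => by rw [ofIsAdjointPair_apply, ofIsAdjointPair_apply, h]

theorem map_op_smul (T : Adjointable A X) (a : A) (x : X) : T (op a • x) = op a • T x :=
  ext_ip A fun z => by simp only [← T.ip_apply_left.symm z, ip_mul_right]

noncomputable instance : PartialOrder (Adjointable A X) := CStarAlgebra.spectralOrder _

instance : StarOrderedRing (Adjointable A X) := CStarAlgebra.spectralOrderedRing _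

theorem ip_apply_nonneg {T : Adjointable A X} (hT : 0 ≤ T) (x : X) : 0 ≤ ip A x (T x) := by
  obtain ⟨S, rfl⟩ := CStarAlgebra.nonneg_iff_eq_star_mul_self.mp hT
  rw [mul_apply, ← S.ip_apply_left]
  exact ip_self_nonneg A _

variable (A) in
/-- The compression `T ↦ ⟨x, T x⟩` of adjointable operators to the vector `x`. -/
noncomputable def compression (x : X) : Adjointable A X →ₚ[ℝ] A :=
  .mk₀ { toFun := fun T => ip A x (T x)
         map_add' := fun _ _ => ip_add_right A _ _ _
         map_smul' := fun r T => ip_real_smul_right r x (T x) } fun _ hT => ip_apply_nonneg hT x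

theorem compression_apply (x : X) (T : Adjointable A X) : compression A x T = ip A x (T x) := rfl

theorem isSelfAdjoint_compression {T : Adjointable A X} (hT : IsSelfAdjoint T) (x : X) :
    IsSelfAdjoint (compression A x T) := by
  rw [isSelfAdjoint_iff, compression_apply, star_ip, T.ip_apply_left, hT.star_eq]

theorem spectrum_compression_subset {J : Set ℝ} (hJ : J.OrdConnected) {T : Adjointable A X}
    (hT : IsSelfAdjoint T) (hTJ : spectrum ℝ T ⊆ J) {x : X} (hx : ip A x x = 1) :
    spectrum ℝ (compression A x T) ⊆ J :=
  spectrum_map_subset_of_ordConnected (compression A x) hx hJ hT hTJ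

variable (A) in
/-- The operator `z ↦ x⟨y, z⟩`, often denoted `|x⟩⟨y|`. -/
noncomputable def rankOne (x y : X) : Adjointable A X :=
  ofIsAdjointPair (A := A) (T := fun z => op (ip A y z) • x) (S := fun z => op (ip A x z) • y)
    fun z w => by rw [ip_op_smul_left, ip_mul_right, star_ip]

theorem rankOne_apply (x y z : X) : rankOne A x y z = op (ip A y z) • x :=
  ofIsAdjointPair_apply _ z

theorem isStarProjection_rankOne_self {x : X} (hx : ip A x x = 1) :
    IsStarProjection (rankOne A x x : Adjointable A X) where
  isIdempotentElem := ext fun z => by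
    rw [mul_apply, rankOne_apply (z := z), map_op_smul, rankOne_apply, hx, op_one, one_smul]
  isSelfAdjoint := star_ofIsAdjointPair _

variable (A) in
/-- The pairs `(T, a)` for which `x` is an eigenvector of `T` and of `T*` with right eigenvalues
`a` and `a*`; being a closed star subalgebra, this set is stable under the functional calculus. -/
def eigenpairs (x : X) : StarSubalgebra ℂ (Adjointable A X × A) where
  carrier := {q | q.1 x = op q.2 • x ∧ (star q.1 : Adjointable A X) x = op (star q.2) • x}
  mul_mem' := by
    rintro ⟨T, a⟩ ⟨S, b⟩ ⟨hT, hT'⟩ ⟨hS, hS'⟩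
    constructor
    · simp only [Prod.mk_mul_mk, mul_apply, hS, map_op_smul, hT, smul_smul, op_mul]
    · simp only [Prod.mk_mul_mk, star_mul, mul_apply, hT', map_op_smul, hS', smul_smul, op_mul]
  add_mem' := by
    rintro ⟨T, a⟩ ⟨S, b⟩ ⟨hT, hT'⟩ ⟨hS, hS'⟩
    constructor
    · simp only [Prod.mk_add_mk, add_apply, hS, hT, add_smul, op_add]
    · simp only [Prod.mk_add_mk, star_add, add_apply, hS', hT', add_smul, op_add]
  algebraMap_mem' c := by
    have scalar (c : ℂ) : (algebraMap ℂ (Adjointable A X) c) x = op (algebraMap ℂ A c) • x := by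
      rw [Algebra.algebraMap_eq_smul_one, Algebra.algebraMap_eq_smul_one, op_smul, op_one]
      change c • x = _
      refine ext_ip A fun z => ?_
      simp [ip]
    refine ⟨scalar c, ?_⟩
    simpa only [Prod.algebraMap_apply, algebraMap_star_comm] using scalar (star c)
  star_mem' := by
    rintro ⟨T, a⟩ ⟨hT, hT'⟩
    exact ⟨hT', by simpa using hT⟩

variable (A) in
theorem isClosed_eigenpairs (x : X) : IsClosed (eigenpairs A x : Set (Adjointable A X × A)) := by
  have continuous_eval : Continuous fun T : Adjointable A X => T x :=
    (ContinuousLinearMap.apply ℂ X x).continuous.comp continuous_subtype_val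
  have setOf_eq : {q : Adjointable A X × A | q.1 x = op q.2 • x} =
      ⋂ z, {q | ip A z (q.1 x) = ip A z x * q.2} := by
    ext q
    simp only [Set.mem_iInter, Set.mem_ofPred_eq, ← ip_mul_right]
    exact ⟨fun h z => by rw [h], ext_ip A⟩
  have isClosed_setOf : IsClosed {q : Adjointable A X × A | q.1 x = op q.2 • x} := by
    rw [setOf_eq]
    refine isClosed_iInter fun z => isClosed_eq ?_ (continuous_const.mul continuous_snd)
    exact (continuous_ip A).comp (continuous_const.prodMk (continuous_eval.comp continuous_fst))
  exact isClosed_setOf.inter (isClosed_setOf.preimage continuous_star)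

theorem cfc_apply_eigenvector {T : Adjointable A X} {a : A} (hT : IsSelfAdjoint T)
    (ha : IsSelfAdjoint a) {x : X} (hx : T x = op a • x) {f : ℝ → ℝ}
    (hf : ContinuousOn f (spectrum ℝ T ∪ spectrum ℝ a)) : cfc f T x = op (cfc f a) • x := by
  have hmem : (T, a) ∈ eigenpairs A x := ⟨hx, by simpa only [hT.star_eq, ha.star_eq] using hx⟩
  exact (prodMk_cfc_mem (isClosed_eigenpairs A x) hT ha hf hmem).1

theorem pinching_rankOne_self_apply {x : X} (hx : ip A x x = 1) (T : Adjointable A X) :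
    pinching (rankOne A x x) T x = op (compression A x T) • x := by
  set p : Adjointable A X := rankOne A x x
  have hpx : p x = x := by rw [rankOne_apply, hx, op_one, one_smul]
  have hqx : (1 - p) x = 0 := sub_eq_zero.mpr hpx.symm
  rw [pinching, add_apply, mul_apply, mul_apply, mul_apply, mul_apply, hpx, hqx, map_zero,
    map_zero, add_zero, rankOne_apply, compression_apply]

theorem compression_pinching_rankOne_self {x : X} (hx : ip A x x = 1) (T : Adjointable A X) :
    compression A x (pinching (rankOne A x x) T) = compression A x T := by
  rw [compression_apply, pinching_rankOne_self_apply hx, ip_mul_right, hx, one_mul]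

theorem cfc_compression_le {J : Set ℝ} {f : ℝ → ℝ} (hf : OperatorConvexOn.{v} J f)
    (hJ : J.OrdConnected) {T : Adjointable A X} (hT : IsSelfAdjoint T) (hTJ : spectrum ℝ T ⊆ J)
    {x : X} (hx : ip A x x = 1) : cfc f (compression A x T) ≤ compression A x (cfc f T) := by
  set p : Adjointable A X := rankOne A x x
  have hp : IsStarProjection p := isStarProjection_rankOne_self hx
  have hspec := Set.union_subset (spectrum_pinching_subset hJ hp hT hTJ)
    (spectrum_compression_subset hJ hT hTJ hx)
  calc cfc f (compression A x T) = compression A x (cfc f (pinching p T)) := by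
        rw [compression_apply x (cfc f (pinching p T)),
          cfc_apply_eigenvector (isSelfAdjoint_pinching hp hT) (isSelfAdjoint_compression hT x)
            (pinching_rankOne_self_apply hx T) (hf.1.mono hspec),
          ip_mul_right, hx, one_mul]
    _ ≤ compression A x (pinching p (cfc f T)) :=
        OrderHomClass.mono _ (hf.cfc_pinching_le hJ hp hT hTJ)
    _ = compression A x (cfc f T) := compression_pinching_rankOne_self hx _

end Adjointable

end Adjointable

section Diagonal

open scoped WithCStarModule

variable {A : Type u} [CStarAlgebra A] [PartialOrder A] [StarOrderedRing A]

/-- The star homomorphism into `𝓛(X)` given by an action `F` of a star algebra on `X` in which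
`F (star b)` is an adjoint of `F b`; the operators `F b` need not be known to be linear. -/
noncomputable def Adjointable.starAlgHomOfIsAdjointPair {B X : Type*} [Semiring B] [Algebra ℂ B]
    [Star B] [NormedAddCommGroup X] [NormedSpace ℂ X] [Module Aᵐᵒᵖ X] [CStarModule Aᵐᵒᵖ X]
    [CompleteSpace X] (F : B → X → X) (adjoint : ∀ b, IsAdjointPair A (F b) (F (star b)))
    (map_mul : ∀ b c x, F (b * c) x = F b (F c x))
    (map_add : ∀ b c x, F (b + c) x = F b x + F c x)
    (map_algebraMap : ∀ (r : ℂ) x, F (algebraMap ℂ B r) x = r • x) :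
    B →⋆ₐ[ℂ] Adjointable A X where
  toFun b := ofIsAdjointPair (adjoint b)
  map_one' := ext fun x => by
    rw [ofIsAdjointPair_apply, ← map_one (algebraMap ℂ B), map_algebraMap, one_smul]
    rfl
  map_mul' b c := ext fun x => by
    simp only [mul_apply, ofIsAdjointPair_apply, map_mul]
  map_zero' := ext fun x => by
    rw [ofIsAdjointPair_apply, ← map_zero (algebraMap ℂ B), map_algebraMap, zero_smul]
    rfl
  map_add' b c := ext fun x => by
    simp only [add_apply, ofIsAdjointPair_apply, map_add]
  commutes' r := ext fun x => (ofIsAdjointPair_apply _ x).trans (map_algebraMap r x)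
  map_star' b := ((star_ofIsAdjointPair (adjoint b)).trans
    (ext fun x => by simp only [ofIsAdjointPair_apply])).symm

theorem Adjointable.starAlgHomOfIsAdjointPair_apply {B X : Type*} [Semiring B] [Algebra ℂ B]
    [Star B] [NormedAddCommGroup X] [NormedSpace ℂ X] [Module Aᵐᵒᵖ X] [CStarModule Aᵐᵒᵖ X]
    [CompleteSpace X] (F : B → X → X) (adjoint : ∀ b, IsAdjointPair A (F b) (F (star b)))
    (map_mul : ∀ b c x, F (b * c) x = F b (F c x))
    (map_add : ∀ b c x, F (b + c) x = F b x + F c x)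
    (map_algebraMap : ∀ (r : ℂ) x, F (algebraMap ℂ B r) x = r • x) (b : B) (x : X) :
    starAlgHomOfIsAdjointPair F adjoint map_mul map_add map_algebraMap b x = F b x :=
  ofIsAdjointPair_apply (adjoint b) x

section Prod

variable {X : Type v} [NormedAddCommGroup X] [NormedSpace ℂ X] [Module Aᵐᵒᵖ X]
  [CStarModule Aᵐᵒᵖ X] {Y : Type w} [NormedAddCommGroup Y] [NormedSpace ℂ Y] [Module Aᵐᵒᵖ Y]
  [CStarModule Aᵐᵒᵖ Y]

theorem ip_prod (z z' : C⋆ᵐᵒᵈ(Aᵐᵒᵖ, X × Y)) : ip A z z' = ip A z.1 z'.1 + ip A z.2 z'.2 := rfl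

variable [CompleteSpace X] [CompleteSpace Y]

variable (A X Y) in
/-- The diagonal operators `(x, y) ↦ (T x, S y)` on the direct sum of two Hilbert modules. -/
noncomputable def diagonalProd :
    (Adjointable A X × Adjointable A Y) →⋆ₐ[ℂ] Adjointable A C⋆ᵐᵒᵈ(Aᵐᵒᵖ, X × Y) :=
  Adjointable.starAlgHomOfIsAdjointPair
    (fun D z => (WithCStarModule.equiv Aᵐᵒᵖ (X × Y)).symm
      (D.1 (WithCStarModule.equiv Aᵐᵒᵖ (X × Y) z).1, D.2 (WithCStarModule.equiv Aᵐᵒᵖ (X × Y) z).2))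
    (fun D z z' => congrArg₂ (· + ·) (D.1.ip_apply_left z.1 z'.1) (D.2.ip_apply_left z.2 z'.2))
    (fun _ _ _ => rfl) (fun _ _ _ => rfl) (fun _ _ => rfl)

theorem diagonalProd_apply (T : Adjointable A X) (S : Adjointable A Y)
    (z : C⋆ᵐᵒᵈ(Aᵐᵒᵖ, X × Y)) :
    diagonalProd A X Y (T, S) z = (WithCStarModule.equiv Aᵐᵒᵖ (X × Y)).symm (T z.1, S z.2) :=
  Adjointable.starAlgHomOfIsAdjointPair_apply _ _ _ _ _ (T, S) z

theorem ip_diagonalProd_apply (T : Adjointable A X) (S : Adjointable A Y)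
    (z : C⋆ᵐᵒᵈ(Aᵐᵒᵖ, X × Y)) :
    ip A z (diagonalProd A X Y (T, S) z) = ip A z.1 (T z.1) + ip A z.2 (S z.2) := by
  rw [diagonalProd_apply]
  exact ip_prod _ _

theorem isSelfAdjoint_diagonalProd {T : Adjointable A X} {S : Adjointable A Y}
    (hT : IsSelfAdjoint T) (hS : IsSelfAdjoint S) : IsSelfAdjoint (diagonalProd A X Y (T, S)) :=
  IsSelfAdjoint.map (Prod.ext hT hS : IsSelfAdjoint (T, S)) (diagonalProd A X Y)

theorem spectrum_diagonalProd_subset (T : Adjointable A X) (S : Adjointable A Y) :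
    spectrum ℝ (diagonalProd A X Y (T, S)) ⊆ spectrum ℝ T ∪ spectrum ℝ S :=
  (AlgHom.spectrum_apply_subset ((diagonalProd A X Y).restrictScalars ℝ) (T, S)).trans
    (Prod.spectrum_eq (R := ℝ) T S).subset

theorem cfc_diagonalProd {T : Adjointable A X} {S : Adjointable A Y} (hT : IsSelfAdjoint T)
    (hS : IsSelfAdjoint S) {f : ℝ → ℝ} (hf : ContinuousOn f (spectrum ℝ T ∪ spectrum ℝ S)) :
    cfc f (diagonalProd A X Y (T, S)) = diagonalProd A X Y (cfc f T, cfc f S) :=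
  (map_prodMk_cfc (diagonalProd A X Y) hT hS hf).symm

end Prod

section Pi

variable {ι : Type w} [Fintype ι] {E : ι → Type v} [∀ i, NormedAddCommGroup (E i)]
  [∀ i, NormedSpace ℂ (E i)] [∀ i, Module Aᵐᵒᵖ (E i)] [∀ i, CStarModule Aᵐᵒᵖ (E i)]

theorem ip_pi (z z' : C⋆ᵐᵒᵈ(Aᵐᵒᵖ, ∀ i, E i)) : ip A z z' = ∑ i, ip A (z i) (z' i) :=
  Finset.unop_sum _ _

variable [∀ i, CompleteSpace (E i)]

variable (A E) in
/-- The diagonal operators `(x i)ᵢ ↦ (T i (x i))ᵢ` on a finite direct sum of Hilbert modules. -/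
noncomputable def diagonalPi :
    (∀ i, Adjointable A (E i)) →⋆ₐ[ℂ] Adjointable A C⋆ᵐᵒᵈ(Aᵐᵒᵖ, ∀ i, E i) :=
  Adjointable.starAlgHomOfIsAdjointPair
    (fun D z => (WithCStarModule.equiv Aᵐᵒᵖ (∀ i, E i)).symm fun i =>
      D i (WithCStarModule.equiv Aᵐᵒᵖ (∀ i, E i) z i))
    (fun D z z' => by
      rw [ip_pi, ip_pi]
      exact Finset.sum_congr rfl fun i _ => (D i).ip_apply_left (z i) (z' i))
    (fun _ _ _ => rfl) (fun _ _ _ => rfl) (fun _ _ => rfl)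

theorem diagonalPi_apply (T : ∀ i, Adjointable A (E i)) (z : C⋆ᵐᵒᵈ(Aᵐᵒᵖ, ∀ i, E i)) :
    diagonalPi A E T z = (WithCStarModule.equiv Aᵐᵒᵖ (∀ i, E i)).symm fun i => T i (z i) :=
  Adjointable.starAlgHomOfIsAdjointPair_apply _ _ _ _ _ T z

theorem ip_diagonalPi_apply (T : ∀ i, Adjointable A (E i)) (z : C⋆ᵐᵒᵈ(Aᵐᵒᵖ, ∀ i, E i)) :
    ip A z (diagonalPi A E T z) = ∑ i, ip A (z i) (T i (z i)) := by
  rw [diagonalPi_apply]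
  exact ip_pi _ _

theorem isSelfAdjoint_diagonalPi {T : ∀ i, Adjointable A (E i)} (hT : ∀ i, IsSelfAdjoint (T i)) :
    IsSelfAdjoint (diagonalPi A E T) :=
  IsSelfAdjoint.map (funext hT : IsSelfAdjoint T) (diagonalPi A E)

theorem spectrum_diagonalPi_subset (T : ∀ i, Adjointable A (E i)) :
    spectrum ℝ (diagonalPi A E T) ⊆ ⋃ i, spectrum ℝ (T i) :=
  (AlgHom.spectrum_apply_subset ((diagonalPi A E).restrictScalars ℝ) T).trans
    (Pi.spectrum_eq (R := ℝ) T).subset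

theorem cfc_diagonalPi {T : ∀ i, Adjointable A (E i)} (hT : ∀ i, IsSelfAdjoint (T i)) {f : ℝ → ℝ}
    (hf : ContinuousOn f (⋃ i, spectrum ℝ (T i))) :
    cfc f (diagonalPi A E T) = diagonalPi A E fun i => cfc f (T i) :=
  (map_pi_cfc (diagonalPi A E) hT hf).symm

end Pi

end Diagonal

section Jensen

open scoped WithCStarModule

variable {A : Type u} {X : Type v} [CStarAlgebra A] [PartialOrder A] [StarOrderedRing A]
  [NormedAddCommGroup X] [NormedSpace ℂ X] [Module Aᵐᵒᵖ X] [CStarModule Aᵐᵒᵖ X]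

/-- The vector `(√(1 - ⟨x, x⟩), x)` of `A ⊕ X`, a unit vector when `⟨x, x⟩ ≤ 1`. -/
noncomputable def unitDilation (A : Type u) {X : Type v} [CStarAlgebra A] [PartialOrder A]
    [StarOrderedRing A] [NormedAddCommGroup X] [NormedSpace ℂ X] [Module Aᵐᵒᵖ X]
    [CStarModule Aᵐᵒᵖ X] (x : X) : C⋆ᵐᵒᵈ(Aᵐᵒᵖ, Aᵐᵒᵖ × X) :=
  (WithCStarModule.equiv Aᵐᵒᵖ (Aᵐᵒᵖ × X)).symm (op (CFC.sqrt (1 - ip A x x)), x)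

theorem ip_unitDilation_self {x : X} (hx : ip A x x ≤ 1) :
    ip A (unitDilation A x) (unitDilation A x) = 1 := by
  have sqrt_star_mul_self :
      star (CFC.sqrt (1 - ip A x x)) * CFC.sqrt (1 - ip A x x) = 1 - ip A x x := by
    rw [(CFC.sqrt_nonneg _).isSelfAdjoint.star_eq]
    exact CFC.sqrt_mul_sqrt_self _ (sub_nonneg.mpr hx)
  exact (congrArg (· + ip A x x) sqrt_star_mul_self).trans (sub_add_cancel _ _)

variable (A) in
theorem ip_self_le_algebraMap_norm_sq (x : X) : ip A x x ≤ algebraMap ℝ A (‖x‖ ^ 2) := by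
  rw [norm_sq_eq A]
  exact (ip_self_nonneg A x).isSelfAdjoint.le_algebraMap_norm_self

variable (A) in
theorem inv_one_add_sum_norm_sq_smul_le_one {ι : Type*} [Fintype ι] {x : X} (hx : ‖x‖ ≤ 1)
    (y : ι → X) :
    (1 + ∑ i, ‖y i‖ ^ 2)⁻¹ • (ip A x x + ∑ i, ip A (y i) (y i)) ≤ 1 := by
  have hpos : 0 < 1 + ∑ i, ‖y i‖ ^ 2 := by positivity
  have hle : ip A x x + ∑ i, ip A (y i) (y i) ≤ algebraMap ℝ A (1 + ∑ i, ‖y i‖ ^ 2) := by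
    rw [map_add, map_sum]
    gcongr with i
    · exact (ip_self_le_algebraMap_norm_sq A x).trans
        (algebraMap_mono A (pow_le_one₀ (norm_nonneg x) hx))
    · exact ip_self_le_algebraMap_norm_sq A (y i)
  rw [inv_smul_le_iff_of_pos hpos, ← Algebra.algebraMap_eq_smul_one]
  exact hle

variable [CompleteSpace X] {J : Set ℝ} {f : ℝ → ℝ}

theorem ip_cfc_zero_nonpos (hf0 : f 0 ≤ 0) (x : X) :
    ip A x (cfc f (0 : Adjointable A X) x) ≤ 0 := by
  rw [cfc_apply_zero, Algebra.algebraMap_eq_smul_one]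
  change ip A x (f 0 • x) ≤ 0
  rw [ip_real_smul_right]
  exact smul_nonpos_of_nonpos_of_nonneg hf0 (ip_self_nonneg A x)

theorem jensen_of_ip_self_le_one (hf : OperatorConvexOn.{max u v} J f) (hJ : J.OrdConnected)
    (h0J : (0 : ℝ) ∈ J) (hf0 : f 0 ≤ 0) {T : Adjointable A X} (hT : IsSelfAdjoint T)
    (hTJ : spectrum ℝ T ⊆ J) {x : X} (hx : ip A x x ≤ 1) :
    spectrum ℝ (ip A x (T x)) ⊆ J ∧ cfc f (ip A x (T x)) ≤ ip A x (cfc f T x) := by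
  set z := unitDilation A x
  let O : Adjointable A Aᵐᵒᵖ := 0
  set D : Adjointable A C⋆ᵐᵒᵈ(Aᵐᵒᵖ, Aᵐᵒᵖ × X) := diagonalProd A Aᵐᵒᵖ X (O, T)
  have hO : IsSelfAdjoint O := .zero _
  have hOTJ : spectrum ℝ O ∪ spectrum ℝ T ⊆ J :=
    Set.union_subset (spectrum_zero_subset.trans (Set.singleton_subset_iff.mpr h0J)) hTJ
  have hD : IsSelfAdjoint D := isSelfAdjoint_diagonalProd hO hT
  have hDJ : spectrum ℝ D ⊆ J := (spectrum_diagonalProd_subset O T).trans hOTJ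
  have hz : ip A z z = 1 := ip_unitDilation_self hx
  have compression_D : Adjointable.compression A z D = ip A x (T x) := by
    rw [Adjointable.compression_apply, ip_diagonalProd_apply]
    exact add_eq_right.mpr (mul_zero _)
  have compression_cfc_D : Adjointable.compression A z (cfc f D) ≤ ip A x (cfc f T x) := by
    rw [cfc_diagonalProd hO hT (hf.1.mono hOTJ), Adjointable.compression_apply,
      ip_diagonalProd_apply]
    exact add_le_of_nonpos_left (ip_cfc_zero_nonpos hf0 _)
  rw [← compression_D]
  exact ⟨Adjointable.spectrum_compression_subset hJ hD hDJ hz,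
    (Adjointable.cfc_compression_le hf hJ hD hDJ hz).trans compression_cfc_D⟩

theorem jensen_of_smul_ip_self_le_one (hf : OperatorConvexOn.{max u v} J f)
    (hJ : J.OrdConnected) (h0J : (0 : ℝ) ∈ J) (hf0 : f 0 ≤ 0) {T : Adjointable A X}
    (hT : IsSelfAdjoint T) (hTJ : spectrum ℝ T ⊆ J) {x : X} {k : ℝ} (hk : 0 ≤ k)
    (hx : k • ip A x x ≤ 1) :
    spectrum ℝ (k • ip A x (T x)) ⊆ J ∧
      cfc f (k • ip A x (T x)) ≤ k • ip A x (cfc f T x) := by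
  have ip_sqrt_smul (W : Adjointable A X) :
      ip A (√k • x) (W (√k • x)) = k • ip A x (W x) := by
    have map_sqrt_smul : W (√k • x) = √k • W x :=
      ((W : X →L[ℂ] X).restrictScalars ℝ).map_smul _ _
    rw [map_sqrt_smul, ip_real_smul_right, ip_real_smul_left, smul_smul, Real.mul_self_sqrt hk]
  rw [← ip_sqrt_smul, ← ip_sqrt_smul]
  exact jensen_of_ip_self_le_one hf hJ h0J hf0 hT hTJ ((ip_sqrt_smul 1).trans_le hx)

theorem jensen_sum {ι : Type w} [Fintype ι] {E : ι → Type v} [∀ i, NormedAddCommGroup (E i)]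
    [∀ i, NormedSpace ℂ (E i)] [∀ i, Module Aᵐᵒᵖ (E i)] [∀ i, CStarModule Aᵐᵒᵖ (E i)]
    [∀ i, CompleteSpace (E i)] (hf : OperatorConvexOn.{max u v w} J f) (hJ : J.OrdConnected)
    (h0J : (0 : ℝ) ∈ J) (hf0 : f 0 ≤ 0) {T : ∀ i, Adjointable A (E i)}
    (hT : ∀ i, IsSelfAdjoint (T i)) (hTJ : ∀ i, spectrum ℝ (T i) ⊆ J) {y : ∀ i, E i} {k : ℝ}
    (hk : 0 ≤ k) (hy : k • ∑ i, ip A (y i) (y i) ≤ 1) :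
    spectrum ℝ (k • ∑ i, ip A (y i) (T i (y i))) ⊆ J ∧
      cfc f (k • ∑ i, ip A (y i) (T i (y i))) ≤ k • ∑ i, ip A (y i) (cfc f (T i) (y i)) := by
  set z : C⋆ᵐᵒᵈ(Aᵐᵒᵖ, ∀ i, E i) := (WithCStarModule.equiv Aᵐᵒᵖ (∀ i, E i)).symm y
  have hTJ' : ⋃ i, spectrum ℝ (T i) ⊆ J := Set.iUnion_subset hTJ
  have jensen := jensen_of_smul_ip_self_le_one hf hJ h0J hf0 (isSelfAdjoint_diagonalPi hT)
    ((spectrum_diagonalPi_subset T).trans hTJ') hk (x := z) (by rwa [ip_pi])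
  rwa [cfc_diagonalPi hT (hf.1.mono hTJ'), ip_diagonalPi_apply,
    ip_diagonalPi_apply] at jensen

theorem ip_sum_conjugate_apply {ι : Type*} (s : Finset ι) (R V : ι → Adjointable A X) (x : X) :
    ip A x ((∑ i ∈ s, star (R i) * V i * R i) x) = ∑ i ∈ s, ip A (R i x) (V i (R i x)) := by
  rw [Adjointable.sum_apply, ip_sum_right]
  exact Finset.sum_congr rfl fun i _ => ((R i).ip_apply_left x _).symm

end Jensen

end HilbertModule

open HilbertModule in
theorem mainTheorem5_general {A : Type u} [CStarAlgebra A] [PartialOrder A] [StarOrderedRing A]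
    {X : Type v} [NormedAddCommGroup X] [NormedSpace ℂ X] [CompleteSpace X] [Module Aᵐᵒᵖ X]
    [CStarModule Aᵐᵒᵖ X] {J : Set ℝ} (hJ : J.OrdConnected) (h0J : (0 : ℝ) ∈ J) {f : ℝ → ℝ}
    (hf : OperatorConvexOn.{max u v w} J f) (hf0 : f 0 ≤ 0) {ι : Type w} [Fintype ι]
    (S : Adjointable A X) (R T : ι → Adjointable A X) (hS : IsSelfAdjoint S)
    (hT : ∀ i, IsSelfAdjoint (T i)) (hSJ : spectrum ℝ (S - ∑ i, star (R i) * T i * R i) ⊆ J)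
    (hTJ : ∀ i, spectrum ℝ (T i) ⊆ J) (x : X) {k : ℝ} (hk : 0 < k)
    (hx : k • (ip A x x + ∑ i, ip A (R i x) (R i x)) ≤ 1) :
    spectrum ℝ (k • ip A x (S x)) ⊆ J ∧
      k⁻¹ • cfc f (k • ip A x (S x)) ≤
        ip A x ((cfc f (S - ∑ i, star (R i) * T i * R i) +
          ∑ i, star (R i) * cfc f (T i) * R i) x) := by
  let D : Option ι → Adjointable A X := (·.elim (S - ∑ i, star (R i) * T i * R i) T)
  let y : Option ι → X := (·.elim x (R · x))
  have hS' : IsSelfAdjoint (S - ∑ i, star (R i) * T i * R i) :=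
    hS.sub (isSelfAdjoint_sum _ fun i _ => (hT i).conjugate' (R i))
  have jensen := jensen_sum hf hJ h0J hf0 (T := D) (Option.forall.mpr ⟨hS', hT⟩)
    (Option.forall.mpr ⟨hSJ, hTJ⟩) hk.le (y := y) (by rwa [Fintype.sum_option])
  simp only [Fintype.sum_option, D, y, Option.elim, ← ip_sum_conjugate_apply, ← ip_add_right,
    ← Adjointable.add_apply, sub_add_cancel] at jensen
  exact ⟨jensen.1, (inv_smul_le_iff_of_pos hk).mpr jensen.2⟩

theorem mainTheorem5
    {A : Type u} [CStarAlgebra A] [PartialOrder A] [StarOrderedRing A]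
    {X : Type v} [NormedAddCommGroup X] [NormedSpace ℂ X] [CompleteSpace X]
    [Module Aᵐᵒᵖ X] [CStarModule Aᵐᵒᵖ X]
    {J : Set ℝ} (hJ : J.OrdConnected) (h0J : (0 : ℝ) ∈ J)
    {f : ℝ → ℝ} (hf : OperatorConvexOn.{max u v} J f) (hf0 : f 0 ≤ 0)
    {n : ℕ} (S : HilbertModule.Adjointable A X) (R T : Fin n → HilbertModule.Adjointable A X)
    (hS : IsSelfAdjoint S) (hT : ∀ i, IsSelfAdjoint (T i))
    (hSJ : spectrum ℝ (S - ∑ i, star (R i) * T i * R i) ⊆ J)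
    (hTJ : ∀ i, spectrum ℝ (T i) ⊆ J)
    (x : X) (hx : ‖x‖ ≤ 1)
    (k : ℝ) (hk : k = (1 + ∑ i, ‖R i x‖ ^ 2)⁻¹) :
    spectrum ℝ (k • HilbertModule.ip A x (S x)) ⊆ J ∧
      k⁻¹ • cfc f (k • HilbertModule.ip A x (S x)) ≤
        HilbertModule.ip A x
          ((cfc f (S - ∑ i, star (R i) * T i * R i) + ∑ i, star (R i) * cfc f (T i) * R i) x) := by
  subst hk
  exact mainTheorem5_general hJ h0J hf hf0 S R T hS hT hSJ hTJ x (by positivity)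
    (HilbertModule.inv_one_add_sum_norm_sq_smul_le_one A hx _)
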